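/- Let $n\ge 0$, let $K\subseteq\mathbb{R}^n$ be a proper cone (a closed convex cone containing $0$, with $K\cap(-K)=\{0\}$ and with nonempty interior), and let $A$ be a real $n\times n$ matrix with $AK\subseteq K$; write $I$ for the $n\times n$ identity matrix. A face of $K$ is a convex cone $F\subseteq K$ containing $0$ such that $x\in F$, $y\in K$ and $x-y\in K$ imply $y\in F$; $\Phi(S)$ denotes the intersection of all faces of $K$ that include $S\subseteq K$, and $\mathcal N$ denotes the nullspace. A generalized eigenvector of $A$ for $\mu$ is a nonzero $v$ with $(A-\mu I)^pv=0$ for some positive integer $p$, and the least such $p$ is its order. Every $x\in\mathbb{R}^n$ is uniquely a sum of (complex) generalized eigenvectors of $A$ for distinct eigenvalues. For $x\neq0$, the local spectral radius $\rho_x(A)$ is the largest modulus of an eigenvalue that occurs in this sum, and $\mathrm{ord}_A(x)$ is the largest order of the terms of the sum whose eigenvalue has modulus $\rho_x(A)$; for $x=0$ both are $0$. Put $\mathrm{sp}_A(x)=(\rho_x(A),\mathrm{ord}_A(x))$, and let $(\xi_1,\xi_2)\preceq(\eta_1,\eta_2)$ mean that $\xi_1<\eta_1$, or $\xi_1=\eta_1$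 and $\xi_2\le\eta_2$. A real number $\lambda$ is a distinguished eigenvalue of $A$ for $K$ if $Ax=\lambda x$ for some $0\ne x\in K$; then $m_\lambda$ denotes the maximal order of the generalized eigenvectors of $A$ for $\lambda$ that lie in $K$. (1) For every distinguished eigenvalue $\lambda$ of $A$ for $K$, $$(A-\lambda I)K\cap\{b\in K:\rho_b(A)\le\lambda\}=K\cap(A-\lambda I)\,\Phi\big(\mathcal N((\lambda I-A)^n)\cap K\big)$$ $$\subseteq\ \Phi\big(\mathcal N((\lambda I-A)^n)\cap K\big)\cap\{y\in K:\mathrm{sp}_A(y)\preceq(\lambda,m_\lambda-1)\}.$$ (2) For every $b\in K$: if there is an $x\in K$ with $(A-\rho_b(A)I)x=b$, then $b\in(A-\rho_b(A)I)\,\Phi\big(\mathcal N((\rho_b(A)I-A)^n)\cap K\big)$. -/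

import Mathlib

open Matrix
open scoped NNReal Pointwise

/-- A proper cone in `ℝⁿ`: a convex cone containing `0` which is closed, satisfies
`K ∩ (-K) = {0}`, and has nonempty interior. -/
structure IsProperConeIn {n : ℕ} (K : PointedCone ℝ (Fin n → ℝ)) : Prop where
  isClosed : IsClosed (K : Set (Fin n → ℝ))
  pointed : (K : Set (Fin n → ℝ)) ∩ -(K : Set (Fin n → ℝ)) = {0}
  full : (interior (K : Set (Fin n → ℝ))).Nonempty

/-- The set `π(K)` of all real matrices that map `K` into itself. -/
def conePreserving {n : ℕ} (K : PointedCone ℝ (Fin n → ℝ)) : Set (Matrix (Fin n) (Fin n) ℝ) :=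
  {A | ∀ x ∈ K, A *ᵥ x ∈ K}

/-- `Φ(S)`: the intersection of all faces of `K` that include `S`. -/
def faceGen {n : ℕ} (K : PointedCone ℝ (Fin n → ℝ)) (S : Set (Fin n → ℝ)) :
    PointedCone ℝ (Fin n → ℝ) :=
  sInf {F | F.IsFaceOf K ∧ S ⊆ (F : Set (Fin n → ℝ))}

/-- The order of a generalized eigenvector `x` of `A` for the eigenvalue `μ`: the least positive
integer `p` with `(A - μ I)^p x = 0`. -/
noncomputable def genOrder {n : ℕ} {R : Type*} [CommRing R] (A : Matrix (Fin n) (Fin n) R)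
    (μ : R) (x : Fin n → R) : ℕ :=
  sInf {p : ℕ | 0 < p ∧ ((A - μ • 1) ^ p) *ᵥ x = 0}

/-- A real square matrix regarded as a complex matrix. -/
def toComplexMatrix {n : ℕ} (A : Matrix (Fin n) (Fin n) ℝ) : Matrix (Fin n) (Fin n) ℂ :=
  A.map (fun r : ℝ => (r : ℂ))

/-- A real vector regarded as a complex vector. -/
def toComplexVec {n : ℕ} (x : Fin n → ℝ) : Fin n → ℂ := fun i => (x i : ℂ)

/-- The finitely supported family `y` represents the complex vector `x` as a sum of generalized
eigenvectors of `A` for distinct eigenvalues: its nonzero members `y μ` are generalized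
eigenvectors for `μ`, and the sum of all members is `x`. -/
def IsGenEigenRep {n : ℕ} (A : Matrix (Fin n) (Fin n) ℂ) (x : Fin n → ℂ)
    (y : ℂ →₀ (Fin n → ℂ)) : Prop :=
  (∀ μ, ∃ p : ℕ, ((A - μ • 1) ^ p) *ᵥ (y μ) = 0) ∧ (y.sum fun _ v => v) = x

theorem mem_maxGenEigenspace_toLin' {n : ℕ} {R : Type*} [Field R] (A : Matrix (Fin n) (Fin n) R)
    (μ : R) (v : Fin n → R) :
    v ∈ Module.End.maxGenEigenspace (Matrix.toLin' A) μ ↔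
      ∃ p : ℕ, ((A - μ • 1) ^ p) *ᵥ v = 0 := by
  have h : Matrix.toLin' A - μ • (1 : Module.End R (Fin n → R)) = Matrix.toLin' (A - μ • 1) := by
    rw [map_sub, map_smul, Matrix.toLin'_one]; rfl
  rw [Module.End.mem_maxGenEigenspace, h]
  simp only [← Matrix.toLin'_pow, Matrix.toLin'_apply]

theorem existsUnique_genEigenRep {n : ℕ} (A : Matrix (Fin n) (Fin n) ℂ) (x : Fin n → ℂ) :
    ∃! y : ℂ →₀ (Fin n → ℂ), IsGenEigenRep A x y := by
  obtain ⟨y, hy, hyx⟩ := (Submodule.mem_iSup_iff_exists_finsupp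
    (Module.End.maxGenEigenspace (Matrix.toLin' A)) x).1 (by
      rw [Module.End.iSup_maxGenEigenspace_eq_top]; trivial)
  refine ⟨y, ⟨fun μ => (mem_maxGenEigenspace_toLin' A μ _).1 (hy μ), hyx⟩, ?_⟩
  rintro z ⟨hz, hzx⟩
  have hind := (iSupIndep_iff_finsetSum_eq_imp_eq _).1
    (Module.End.independent_maxGenEigenspace (Matrix.toLin' A)) (z.support ∪ y.support) z y
    (fun i _ => ⟨(mem_maxGenEigenspace_toLin' A i _).2 (hz i), hy i⟩) (by
      rw [← Finsupp.sum_of_support_subset z Finset.subset_union_left (fun _ v => v) (by simp),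
        ← Finsupp.sum_of_support_subset y Finset.subset_union_right (fun _ v => v) (by simp),
        hzx, hyx])
  ext1 μ
  by_cases hμ : μ ∈ z.support ∪ y.support
  · exact hind μ hμ
  · simp only [Finset.mem_union, Finsupp.mem_support_iff, not_or, not_not] at hμ
    rw [hμ.1, hμ.2]

/-- The terms in the unique representation of the real vector `x` as a sum of (complex)
generalized eigenvectors of the real matrix `A` for distinct eigenvalues. -/
noncomputable def genEigenRep {n : ℕ} (A : Matrix (Fin n) (Fin n) ℝ) (x : Fin n → ℝ) :
    ℂ →₀ (Fin n → ℂ) :=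
  (existsUnique_genEigenRep (toComplexMatrix A) (toComplexVec x)).choose

theorem genEigenRep_spec {n : ℕ} (A : Matrix (Fin n) (Fin n) ℝ) (x : Fin n → ℝ) :
    IsGenEigenRep (toComplexMatrix A) (toComplexVec x) (genEigenRep A x) :=
  (existsUnique_genEigenRep (toComplexMatrix A) (toComplexVec x)).choose_spec.1

/-- The local spectral radius `ρ_x(A)`: the largest modulus of an eigenvalue that occurs in the
representation of `x` as a sum of generalized eigenvectors; it is `0` for `x = 0`. -/
noncomputable def localSpectralRadius {n : ℕ} (A : Matrix (Fin n) (Fin n) ℝ)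
    (x : Fin n → ℝ) : ℝ :=
  (((genEigenRep A x).support.sup fun μ => ‖μ‖₊ : ℝ≥0) : ℝ)

/-- The order `ord_A(x)`: the maximum of the orders of the generalized eigenvectors for eigenvalues
of modulus `ρ_x(A)` that occur in the representation of `x`; it is `0` for `x = 0`. -/
noncomputable def vecOrder {n : ℕ} (A : Matrix (Fin n) (Fin n) ℝ) (x : Fin n → ℝ) : ℕ :=
  ((genEigenRep A x).support.filter fun μ => ‖μ‖ = localSpectralRadius A x).sup
    fun μ => genOrder (toComplexMatrix A) μ (genEigenRep A x μ)

/-- The spectral pair `sp_A(x) = (ρ_x(A), ord_A(x))`. -/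
noncomputable def spectralPair {n : ℕ} (A : Matrix (Fin n) (Fin n) ℝ) (x : Fin n → ℝ) : ℝ × ℝ :=
  (localSpectralRadius A x, (vecOrder A x : ℝ))

/-- The lexicographic ordering of pairs of real numbers. -/
def PairLE (ξ η : ℝ × ℝ) : Prop := ξ.1 < η.1 ∨ (ξ.1 = η.1 ∧ ξ.2 ≤ η.2)

/-- `lam` is a distinguished eigenvalue of `A` for `K`: it has an eigenvector in `K`. -/
def IsDistinguishedEigenvalue {n : ℕ} (K : PointedCone ℝ (Fin n → ℝ))
    (A : Matrix (Fin n) (Fin n) ℝ) (lam : ℝ) : Prop :=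
  ∃ x ∈ K, x ≠ 0 ∧ A *ᵥ x = lam • x

/-- `x` is a distinguished generalized eigenvector of `A` for `K` corresponding to `lam`. -/
def IsDistinguishedGenEigenvector {n : ℕ} (K : PointedCone ℝ (Fin n → ℝ))
    (A : Matrix (Fin n) (Fin n) ℝ) (lam : ℝ) (x : Fin n → ℝ) : Prop :=
  x ∈ K ∧ x ≠ 0 ∧ ∃ p : ℕ, ((A - lam • 1) ^ p) *ᵥ x = 0

theorem genOrder_le {n : ℕ} {K : PointedCone ℝ (Fin n → ℝ)} {A : Matrix (Fin n) (Fin n) ℝ}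
    {lam : ℝ} {x : Fin n → ℝ} (h : IsDistinguishedGenEigenvector K A lam x) :
    genOrder A lam x ≤ n := by
  obtain ⟨-, hx, hp⟩ := h
  have hn : 0 < n := by
    rcases Nat.eq_zero_or_pos n with rfl | hn
    · exact absurd (Subsingleton.elim x 0) hx
    · exact hn
  refine Nat.sInf_le ⟨hn, ?_⟩
  have h1 := (mem_maxGenEigenspace_toLin' A lam x).2 hp
  have h : Matrix.toLin' A - lam • (1 : Module.End ℝ (Fin n → ℝ)) =
      Matrix.toLin' (A - lam • 1) := by
    rw [map_sub, map_smul, Matrix.toLin'_one]; rfl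
  rw [Module.End.maxGenEigenspace_eq_genEigenspace_finrank, Module.End.mem_genEigenspace_nat,
    Module.finrank_fin_fun, h, LinearMap.mem_ker, ← Matrix.toLin'_pow, Matrix.toLin'_apply] at h1
  exact h1

/-- `m_λ`: the maximal order of the distinguished generalized eigenvectors of `A` for `lam`. -/
noncomputable def maxDistOrder {n : ℕ} (K : PointedCone ℝ (Fin n → ℝ))
    (A : Matrix (Fin n) (Fin n) ℝ) (lam : ℝ) : ℕ :=
  sSup {p : ℕ | ∃ x, IsDistinguishedGenEigenvector K A lam x ∧ genOrder A lam x = p}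

theorem maxDistOrder_isGreatest {n : ℕ} {K : PointedCone ℝ (Fin n → ℝ)}
    {A : Matrix (Fin n) (Fin n) ℝ} {lam : ℝ} (h : IsDistinguishedEigenvalue K A lam) :
    IsGreatest {p : ℕ | ∃ x, IsDistinguishedGenEigenvector K A lam x ∧ genOrder A lam x = p}
      (maxDistOrder K A lam) := by
  have hb : BddAbove {p : ℕ | ∃ x, IsDistinguishedGenEigenvector K A lam x ∧
      genOrder A lam x = p} := ⟨n, by rintro p ⟨x, hx, rfl⟩; exact genOrder_le hx⟩
  obtain ⟨x, hxK, hx0, hx⟩ := h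
  refine ⟨Nat.sSup_mem ⟨_, x, ⟨hxK, hx0, 1, ?_⟩, rfl⟩ hb, fun p hp => le_csSup hb hp⟩
  rw [pow_one, Matrix.sub_mulVec, Matrix.smul_mulVec, Matrix.one_mulVec, hx, sub_self]

/-- The set `N((λI - A)ⁿ) ∩ K`. -/
def genNullCone {n : ℕ} (K : PointedCone ℝ (Fin n → ℝ)) (A : Matrix (Fin n) (Fin n) ℝ)
    (lam : ℝ) : Set (Fin n → ℝ) :=
  {x | ((lam • (1 : Matrix (Fin n) (Fin n) ℝ) - A) ^ n) *ᵥ x = 0} ∩ (K : Set (Fin n → ℝ))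

/-! ### Passage from real to complex matrices and vectors. -/

section Complexification

variable {n : ℕ}

/-! Write `B = A - λI`. The heart is `mem_faceGen_of_sub_smul_mulVec_mem`: if `x` and `b = Bx` lie
in `K` and `ρ_b(A) ≤ λ`, then `x` is dominated by some `u ∈ K` with `Bⁿu = 0`, so `x` lies in the
face. Put `y = Bⁿx`, which has no component at `λ`. If `-y` is a nonnegative combination of the
vectors `AᵏBy = Bⁿ(Aᵏb)`, then `-y = Bⁿv` with `v ∈ K`, and `u = x + v` works.

That `-y` is such a combination follows by separation. Let a functional `g` be nonnegative at `y`
and at all `AᵏBy`. For `s > λ` the resolvent series gives `∑ s⁻ᵏ⁻¹ g(AᵏBy) = (s - λ)F(s) - g(y)`,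
where `F(s) = ∑ s⁻ᵏ⁻¹ g(Aᵏy)`. Since `y` has no component at `λ`, `(s - λ)F(s) → 0` as `s ↓ λ`, so
every `g(AᵏBy)` vanishes. Hence no functional separates nontrivially inside the span of these
vectors, which contains `y`. Part (2) is the case `λ = ρ_b(A)`.

The remaining inclusions rest on `pow_mulVec_genEigenRep_eq_zero_of_le`. A functional dominating the
norm on `K` bounds the resolvent of `x` at `z` by that of any `u ≥ x` at `|z|`, so pole orders of
`x` on a circle are controlled by the pole of `u` at its positive point. This bounds the spectral
radius on the face and the order of `Bx`. -/

theorem toComplexMatrix_eq (A : Matrix (Fin n) (Fin n) ℝ) :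
    toComplexMatrix A = Complex.ofRealHom.mapMatrix A := rfl

theorem toComplexMatrix_pow (A : Matrix (Fin n) (Fin n) ℝ) (k : ℕ) :
    toComplexMatrix (A ^ k) = toComplexMatrix A ^ k := by
  simp only [toComplexMatrix_eq, map_pow]

theorem toComplexMatrix_sub_smul (A : Matrix (Fin n) (Fin n) ℝ) (r : ℝ) :
    toComplexMatrix (A - r • 1) = toComplexMatrix A - (r : ℂ) • 1 := by
  ext i j
  by_cases h : i = j <;> simp [toComplexMatrix, h]

theorem toComplexMatrix_commute {A B : Matrix (Fin n) (Fin n) ℝ} (h : Commute A B) :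
    Commute (toComplexMatrix A) (toComplexMatrix B) := by
  simp only [toComplexMatrix_eq]
  exact h.map _

theorem toComplexMatrix_mulVec (A : Matrix (Fin n) (Fin n) ℝ) (x : Fin n → ℝ) :
    toComplexMatrix A *ᵥ toComplexVec x = toComplexVec (A *ᵥ x) := by
  ext i
  exact (RingHom.map_mulVec Complex.ofRealHom A x i).symm

theorem norm_toComplexVec (x : Fin n → ℝ) : ‖toComplexVec x‖ = ‖x‖ := by
  simp [toComplexVec, Pi.norm_def]

/-- The coordinatewise real part, as a continuous real-linear map. -/
noncomputable def reVec (n : ℕ) : (Fin n → ℂ) →L[ℝ] (Fin n → ℝ) :=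
  ContinuousLinearMap.pi fun i => Complex.reCLM.comp (ContinuousLinearMap.proj i)

theorem reVec_ofReal_smul (r : ℝ) (x : Fin n → ℝ) :
    reVec n ((r : ℂ) • toComplexVec x) = r • x := by
  ext i
  simp [reVec, toComplexVec]

end Complexification

/-! ### Spectral components and the local spectral radius. -/

section Representation

variable {n : ℕ}

theorem pow_mulVec_eq_zero_of_exists {R : Type*} [Field R] {A : Matrix (Fin n) (Fin n) R} {μ : R}
    {v : Fin n → R} (h : ∃ p : ℕ, ((A - μ • 1) ^ p) *ᵥ v = 0) : ((A - μ • 1) ^ n) *ᵥ v = 0 := by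
  have h1 := (mem_maxGenEigenspace_toLin' A μ v).2 h
  have h2 : Matrix.toLin' A - μ • (1 : Module.End R (Fin n → R)) = Matrix.toLin' (A - μ • 1) := by
    rw [map_sub, map_smul, Matrix.toLin'_one]; rfl
  rwa [Module.End.maxGenEigenspace_eq_genEigenspace_finrank, Module.End.mem_genEigenspace_nat,
    Module.finrank_fin_fun, h2, LinearMap.mem_ker, ← Matrix.toLin'_pow, Matrix.toLin'_apply] at h1

theorem pow_mulVec_eq_zero_of_le {R : Type*} [CommRing R] {B : Matrix (Fin n) (Fin n) R}
    {v : Fin n → R} {p q : ℕ} (hpq : p ≤ q) (h : (B ^ p) *ᵥ v = 0) : (B ^ q) *ᵥ v = 0 := by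
  obtain ⟨k, rfl⟩ := Nat.exists_eq_add_of_le' hpq
  rw [pow_add, ← Matrix.mulVec_mulVec, h, Matrix.mulVec_zero]

theorem pow_mulVec_genEigenRep (A : Matrix (Fin n) (Fin n) ℝ) (x : Fin n → ℝ) (μ : ℂ) :
    ((toComplexMatrix A - μ • 1) ^ n) *ᵥ genEigenRep A x μ = 0 :=
  pow_mulVec_eq_zero_of_exists ((genEigenRep_spec A x).1 μ)

theorem genEigenRep_sum (A : Matrix (Fin n) (Fin n) ℝ) (x : Fin n → ℝ) :
    ∑ μ ∈ (genEigenRep A x).support, genEigenRep A x μ = toComplexVec x :=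
  (genEigenRep_spec A x).2

theorem genEigenRep_eq {A : Matrix (Fin n) (Fin n) ℝ} {x : Fin n → ℝ} {y : ℂ →₀ (Fin n → ℂ)}
    (h : IsGenEigenRep (toComplexMatrix A) (toComplexVec x) y) : genEigenRep A x = y :=
  (existsUnique_genEigenRep (toComplexMatrix A) (toComplexVec x)).unique (genEigenRep_spec A x) h

theorem genEigenRep_mulVec {A B : Matrix (Fin n) (Fin n) ℝ} (hAB : Commute A B)
    (x : Fin n → ℝ) (μ : ℂ) :
    genEigenRep A (B *ᵥ x) μ = toComplexMatrix B *ᵥ genEigenRep A x μ := by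
  have hc (μ : ℂ) : Commute (toComplexMatrix A - μ • 1) (toComplexMatrix B) :=
    (toComplexMatrix_commute hAB).sub_left ((Commute.one_left _).smul_left μ)
  have h : IsGenEigenRep (toComplexMatrix A) (toComplexVec (B *ᵥ x))
      ((genEigenRep A x).mapRange (toComplexMatrix B *ᵥ ·) (Matrix.mulVec_zero _)) := by
    refine ⟨fun μ => ⟨n, ?_⟩, ?_⟩
    · rw [Finsupp.mapRange_apply, Matrix.mulVec_mulVec, ((hc μ).pow_left n).eq,
        ← Matrix.mulVec_mulVec, pow_mulVec_genEigenRep, Matrix.mulVec_zero]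
    · rw [Finsupp.sum_mapRange_index (by simp), Finsupp.sum, ← Matrix.mulVec_sum,
        genEigenRep_sum, toComplexMatrix_mulVec]
  rw [genEigenRep_eq h, Finsupp.mapRange_apply]

theorem genEigenRep_sub_smul_pow_mulVec (A : Matrix (Fin n) (Fin n) ℝ) (r : ℝ) (p : ℕ)
    (x : Fin n → ℝ) (μ : ℂ) :
    genEigenRep A ((A - r • 1) ^ p *ᵥ x) μ =
      (toComplexMatrix A - (r : ℂ) • 1) ^ p *ᵥ genEigenRep A x μ := by
  rw [genEigenRep_mulVec (((Commute.refl A).sub_right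
    ((Commute.one_right A).smul_right r)).pow_right p), toComplexMatrix_pow,
    toComplexMatrix_sub_smul]

theorem genEigenRep_of_pow_mulVec_eq_zero {A : Matrix (Fin n) (Fin n) ℝ} {r : ℝ} {p : ℕ}
    {x : Fin n → ℝ} (h : (A - r • 1) ^ p *ᵥ x = 0) :
    genEigenRep A x = Finsupp.single (r : ℂ) (toComplexVec x) := by
  refine genEigenRep_eq ⟨fun μ => ?_, Finsupp.sum_single_index rfl⟩
  by_cases hμ : (r : ℂ) = μ
  · refine ⟨p, ?_⟩
    rw [← hμ, Finsupp.single_eq_same, ← toComplexMatrix_sub_smul, ← toComplexMatrix_pow,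
      toComplexMatrix_mulVec, h]
    ext; simp [toComplexVec]
  · exact ⟨0, by rw [Finsupp.single_eq_of_ne' hμ, Matrix.mulVec_zero]⟩

theorem toComplexVec_eq_zero_iff {x : Fin n → ℝ} : toComplexVec x = 0 ↔ x = 0 := by
  rw [← norm_eq_zero, norm_toComplexVec, norm_eq_zero]

theorem genEigenRep_eq_zero_iff {A : Matrix (Fin n) (Fin n) ℝ} {x : Fin n → ℝ} :
    genEigenRep A x = 0 ↔ x = 0 := by
  constructor
  · intro h
    rw [← toComplexVec_eq_zero_iff, ← genEigenRep_sum A x, h]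
    simp
  · rintro rfl
    refine genEigenRep_eq ⟨fun μ => ⟨0, by simp⟩, ?_⟩
    rw [Finsupp.sum_zero_index, eq_comm, toComplexVec_eq_zero_iff]

theorem eq_zero_of_sub_smul_mulVec_eq_zero {T : Matrix (Fin n) (Fin n) ℂ} {μ c : ℂ} (hμ : μ ≠ c)
    {v : Fin n → ℂ} {p q : ℕ} (hp : (T - μ • 1) ^ p *ᵥ v = 0) (hq : (T - c • 1) ^ q *ᵥ v = 0) :
    v = 0 := by
  have h := Module.End.independent_maxGenEigenspace (Matrix.toLin' T)
  exact Submodule.disjoint_def.1 (h.pairwiseDisjoint hμ) v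
    ((mem_maxGenEigenspace_toLin' T μ v).2 ⟨p, hp⟩) ((mem_maxGenEigenspace_toLin' T c v).2 ⟨q, hq⟩)

theorem norm_le_localSpectralRadius {A : Matrix (Fin n) (Fin n) ℝ} {x : Fin n → ℝ} {μ : ℂ}
    (h : genEigenRep A x μ ≠ 0) : ‖μ‖ ≤ localSpectralRadius A x :=
  NNReal.coe_le_coe.2
    (Finset.le_sup (f := fun μ : ℂ => ‖μ‖₊) (Finsupp.mem_support_iff.2 h))

theorem localSpectralRadius_le {A : Matrix (Fin n) (Fin n) ℝ} {x : Fin n → ℝ} {r : ℝ}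
    (hr : 0 ≤ r) (h : ∀ μ, genEigenRep A x μ ≠ 0 → ‖μ‖ ≤ r) : localSpectralRadius A x ≤ r := by
  lift r to ℝ≥0 using hr
  exact NNReal.coe_le_coe.2 (Finset.sup_le fun μ hμ =>
    NNReal.coe_le_coe.1 (h μ (Finsupp.mem_support_iff.1 hμ)))

theorem localSpectralRadius_nonneg (A : Matrix (Fin n) (Fin n) ℝ) (x : Fin n → ℝ) :
    0 ≤ localSpectralRadius A x := NNReal.coe_nonneg _

theorem localSpectralRadius_mulVec_le {A B : Matrix (Fin n) (Fin n) ℝ} (hAB : Commute A B)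
    (x : Fin n → ℝ) : localSpectralRadius A (B *ᵥ x) ≤ localSpectralRadius A x := by
  refine localSpectralRadius_le (localSpectralRadius_nonneg A x) fun μ hμ => ?_
  refine norm_le_localSpectralRadius fun h => hμ ?_
  rw [genEigenRep_mulVec hAB, h, Matrix.mulVec_zero]

theorem exists_norm_eq_localSpectralRadius {A : Matrix (Fin n) (Fin n) ℝ} {x : Fin n → ℝ}
    (hx : x ≠ 0) : ∃ μ, genEigenRep A x μ ≠ 0 ∧ ‖μ‖ = localSpectralRadius A x := by
  have hne : (genEigenRep A x).support.Nonempty :=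
    Finsupp.support_nonempty_iff.2 fun h => hx (genEigenRep_eq_zero_iff.1 h)
  obtain ⟨μ, hμ, h⟩ := Finset.exists_mem_eq_sup _ hne fun μ : ℂ => ‖μ‖₊
  exact ⟨μ, Finsupp.mem_support_iff.1 hμ, congrArg NNReal.toReal h.symm⟩

end Representation

/-! ### A functional dominating the norm on the cone. -/

section StrictlyPositiveFunctional

variable {n : ℕ} {K : PointedCone ℝ (Fin n → ℝ)}

theorem IsProperConeIn.eq_zero_of_neg_mem (hK : IsProperConeIn K) {v : Fin n → ℝ} (hv : v ∈ K)
    (hv' : -v ∈ K) : v = 0 := by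
  have h : v ∈ (K : Set (Fin n → ℝ)) ∩ -(K : Set (Fin n → ℝ)) := ⟨hv, hv'⟩
  rwa [hK.pointed] at h

/-- Pointedness gives, for each unit `v ∈ K`, a functional nonnegative on `K` and positive at `v`.
By compactness of the unit slice of `K`, a finite sum of these is bounded below there by some `c >
0`; dividing by `c` gives the claim. -/
theorem IsProperConeIn.exists_pos_functional (hK : IsProperConeIn K) :
    ∃ f : StrongDual ℝ (Fin n → ℝ), (∀ v ∈ K, ‖v‖ ≤ f v) := by
  have hC : IsCompact ((K : Set (Fin n → ℝ)) ∩ Metric.sphere 0 1) :=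
    (isCompact_sphere 0 1).inter_left hK.isClosed
  have hex : ∀ v ∈ (K : Set (Fin n → ℝ)) ∩ Metric.sphere 0 1,
      ∃ f : StrongDual ℝ (Fin n → ℝ), (∀ w ∈ K, 0 ≤ f w) ∧ 0 < f v := by
    rintro v ⟨hv, hv1⟩
    have hneg : -v ∉ (⟨K, hK.isClosed⟩ : ProperCone ℝ (Fin n → ℝ)) := by
      intro h
      rw [hK.eq_zero_of_neg_mem hv h] at hv1
      simp at hv1
    obtain ⟨f, hf, hfv⟩ := ProperCone.hyperplane_separation_point _ hneg
    exact ⟨f, hf, by simpa using hfv⟩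
  choose! g hg hgv using hex
  obtain ⟨t, ht, hcov⟩ := hC.elim_nhds_subcover (fun v => {w | 0 < g v w})
    fun v hv => (isOpen_lt continuous_const (g v).continuous).mem_nhds (hgv v hv)
  set f : StrongDual ℝ (Fin n → ℝ) := ∑ v ∈ t, g v with hf
  have hpos : ∀ w ∈ (K : Set (Fin n → ℝ)) ∩ Metric.sphere 0 1, 0 < f w := by
    intro w hw
    obtain ⟨v, hv, hvw⟩ := Set.mem_iUnion₂.1 (hcov hw)
    rw [hf, _root_.sum_apply]
    exact Finset.sum_pos' (fun i hi => hg i (ht i hi) w hw.1) ⟨v, hv, hvw⟩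
  obtain ⟨c, hc, hcf⟩ : ∃ c : ℝ, 0 < c ∧ ∀ w ∈ (K : Set (Fin n → ℝ)) ∩ Metric.sphere 0 1,
      c ≤ f w := by
    rcases ((K : Set (Fin n → ℝ)) ∩ Metric.sphere 0 1).eq_empty_or_nonempty with he | hne
    · exact ⟨1, one_pos, by simp [he]⟩
    · obtain ⟨w, hw, hmin⟩ := hC.exists_isMinOn hne f.continuous.continuousOn
      exact ⟨f w, hpos w hw, fun v hv => hmin hv⟩
  refine ⟨c⁻¹ • f, fun v hv => ?_⟩
  rcases eq_or_ne v 0 with rfl | hv0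
  · simp
  · have hvn : 0 < ‖v‖ := norm_pos_iff.2 hv0
    have h := hcf (‖v‖⁻¹ • v) ⟨K.smul_mem (inv_nonneg.2 hvn.le) hv, by
      simp [norm_smul, hvn.ne']⟩
    rw [map_smul, smul_eq_mul, inv_mul_eq_div, le_div_iff₀ hvn] at h
    rw [_root_.smul_apply, smul_eq_mul, inv_mul_eq_div, le_div_iff₀ hc]
    linarith

end StrictlyPositiveFunctional

/-! ### Partial fractions, Neumann series and poles of the local resolvent. -/

section Resolvent

open Filter Topology

variable {n : ℕ}

/-- This is the `i`-th derivative of the geometric series, up to a factor. Terms with `k < i` vanish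
through the binomial coefficient, so the truncated exponent is harmless. -/
theorem hasSum_choose_mul_pow_sub {z μ : ℂ} (h : ‖μ‖ < ‖z‖) (i : ℕ) :
    HasSum (fun k : ℕ => (z⁻¹) ^ (k + 1) * ((k.choose i : ℂ) * μ ^ (k - i)))
      (((z - μ)⁻¹) ^ (i + 1)) := by
  have hz : z ≠ 0 := norm_pos_iff.1 ((norm_nonneg μ).trans_lt h)
  have hzμ : z - μ ≠ 0 := sub_ne_zero.2 fun e => h.ne (by rw [e])
  have hr : ‖μ / z‖ < 1 := by rwa [norm_div, div_lt_one ((norm_nonneg μ).trans_lt h)]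
  have h1 := (hasSum_choose_mul_geometric_of_norm_lt_one i hr).mul_left ((z⁻¹) ^ (i + 1))
  have h2 : (z⁻¹) ^ (i + 1) * (1 / (1 - μ / z) ^ (i + 1)) = ((z - μ)⁻¹) ^ (i + 1) := by
    rw [one_div, ← inv_pow, ← mul_pow, ← mul_inv]
    congr 2
    field_simp
  rw [h2] at h1
  refine ((add_left_injective i).hasSum_iff ?_).1 (h1.congr_fun ?_)
  · intro k hk
    have : k < i := by
      by_contra hki
      exact hk ⟨k - i, Nat.sub_add_cancel (not_lt.1 hki)⟩
    simp [Nat.choose_eq_zero_of_lt this]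
  · intro k
    simp only [Function.comp, Nat.add_sub_cancel, div_eq_mul_inv, mul_pow]
    ring

theorem pow_mulVec_eq_sum_range (T : Matrix (Fin n) (Fin n) ℂ) (μ : ℂ) {N : ℕ} {v : Fin n → ℂ}
    (hv : (T - μ • 1) ^ N *ᵥ v = 0) (k : ℕ) :
    T ^ k *ᵥ v = ∑ i ∈ Finset.range N,
      ((k.choose i : ℂ) * μ ^ (k - i)) • ((T - μ • 1) ^ i *ᵥ v) := by
  have hc : Commute (T - μ • 1) (μ • (1 : Matrix (Fin n) (Fin n) ℂ)) :=
    (Commute.one_right _).smul_right μ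
  have h1 : T ^ k *ᵥ v = ∑ i ∈ Finset.range (k + 1),
      ((k.choose i : ℂ) * μ ^ (k - i)) • ((T - μ • 1) ^ i *ᵥ v) := by
    conv_lhs => rw [← sub_add_cancel T (μ • 1), hc.add_pow, Matrix.sum_mulVec]
    refine Finset.sum_congr rfl fun i _ => ?_
    rw [← Matrix.smul_mulVec]
    congr 1
    rw [smul_pow, one_pow, mul_smul_comm, mul_one, ← nsmul_eq_mul', ← Nat.cast_smul_eq_nsmul ℂ,
      smul_smul]
  rw [h1]
  rcases le_total (k + 1) N with hkN | hkN
  · refine Finset.sum_subset (Finset.range_subset_range.2 hkN) fun i _ hi => ?_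
    rw [Finset.mem_range, not_lt] at hi
    rw [Nat.choose_eq_zero_of_lt hi, Nat.cast_zero, zero_mul, zero_smul]
  · refine (Finset.sum_subset (Finset.range_subset_range.2 hkN) fun i _ hi => ?_).symm
    rw [Finset.mem_range, not_lt] at hi
    rw [pow_mulVec_eq_zero_of_le hi hv, smul_zero]

theorem hasSum_pow_mulVec {T : Matrix (Fin n) (Fin n) ℂ} {z μ : ℂ} (h : ‖μ‖ < ‖z‖) {N : ℕ}
    {v : Fin n → ℂ} (hv : (T - μ • 1) ^ N *ᵥ v = 0) :
    HasSum (fun k : ℕ => (z⁻¹) ^ (k + 1) • (T ^ k *ᵥ v))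
      (∑ i ∈ Finset.range N, ((z - μ)⁻¹) ^ (i + 1) • ((T - μ • 1) ^ i *ᵥ v)) := by
  have h1 := hasSum_sum (s := Finset.range N) fun i _ =>
    (hasSum_choose_mul_pow_sub h i).smul_const ((T - μ • 1) ^ i *ᵥ v)
  refine h1.congr_fun fun k => ?_
  rw [pow_mulVec_eq_sum_range T μ hv k, Finset.smul_sum]
  exact Finset.sum_congr rfl fun i _ => smul_smul _ _ _

/-- The value at `x` of the resolvent of `A` at `z`, in partial fractions. -/
noncomputable def localResolvent (A : Matrix (Fin n) (Fin n) ℝ) (x : Fin n → ℝ) (z : ℂ) :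
    Fin n → ℂ :=
  ∑ μ ∈ (genEigenRep A x).support, ∑ i ∈ Finset.range n,
    ((z - μ)⁻¹) ^ (i + 1) • ((toComplexMatrix A - μ • 1) ^ i *ᵥ genEigenRep A x μ)

theorem hasSum_localResolvent {A : Matrix (Fin n) (Fin n) ℝ} {x : Fin n → ℝ} {z : ℂ}
    (hz : localSpectralRadius A x < ‖z‖) :
    HasSum (fun k : ℕ => (z⁻¹) ^ (k + 1) • toComplexVec (A ^ k *ᵥ x)) (localResolvent A x z) := by
  have h := hasSum_sum (s := (genEigenRep A x).support) fun μ hμ =>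
    hasSum_pow_mulVec (T := toComplexMatrix A)
      ((norm_le_localSpectralRadius (Finsupp.mem_support_iff.1 hμ)).trans_lt hz)
      (pow_mulVec_genEigenRep A x μ)
  refine h.congr_fun fun k => ?_
  rw [← Finset.smul_sum, ← Matrix.mulVec_sum, genEigenRep_sum, ← toComplexMatrix_pow,
    toComplexMatrix_mulVec]

theorem hasSum_functional_localResolvent {A : Matrix (Fin n) (Fin n) ℝ} {x : Fin n → ℝ} {s : ℝ}
    (hs : localSpectralRadius A x < s) (f : StrongDual ℝ (Fin n → ℝ)) :
    HasSum (fun k : ℕ => (s⁻¹) ^ (k + 1) * f (A ^ k *ᵥ x))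
      (f (reVec n (localResolvent A x s))) := by
  have h := ((f.comp (reVec n)).hasSum (hasSum_localResolvent (A := A) (x := x) (z := (s : ℂ)) (by
    rw [Complex.norm_real]; exact hs.trans_le (le_abs_self s))))
  refine h.congr_fun fun k => ?_
  rw [ContinuousLinearMap.comp_apply, ← Complex.ofReal_inv, ← Complex.ofReal_pow,
    reVec_ofReal_smul, map_smul, smul_eq_mul]

/-- The second alternative is the divergent range; in the application the vector coefficient of such
a term is zero. -/
theorem tendsto_pow_mul_inv_pow (c : ℂ) (q i : ℕ) :
    Tendsto (fun z : ℂ => (z - c) ^ (q + 1) * ((z - c)⁻¹) ^ (i + 1)) (𝓝[≠] c)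
      (𝓝 (if i = q then 1 else 0)) ∨ q < i := by
  rcases lt_or_ge q i with h | h
  · exact Or.inr h
  left
  have hev : (fun z : ℂ => (z - c) ^ (q - i)) =ᶠ[𝓝[≠] c]
      fun z : ℂ => (z - c) ^ (q + 1) * ((z - c)⁻¹) ^ (i + 1) := by
    filter_upwards [self_mem_nhdsWithin] with z hz
    have hz' : z - c ≠ 0 := sub_ne_zero.2 hz
    rw [show q + 1 = (q - i) + (i + 1) by omega, pow_add, mul_assoc, ← mul_pow,
      mul_inv_cancel₀ hz', one_pow, mul_one]
  refine Tendsto.congr' hev ?_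
  have hcont : Tendsto (fun z : ℂ => (z - c) ^ (q - i)) (𝓝[≠] c) (𝓝 ((c - c) ^ (q - i))) :=
    ((continuous_id.sub continuous_const).pow _).continuousAt.tendsto.mono_left nhdsWithin_le_nhds
  convert hcont using 2
  rw [sub_self]
  split_ifs with hiq
  · rw [hiq, Nat.sub_self, pow_zero]
  · rw [zero_pow (by omega)]

/-- Under `hq` the pole at `c` has order at most `q + 1`, and the limit is the Laurent coefficient
of that order. It is zero exactly when the order drops further. -/
theorem tendsto_sub_pow_smul_localResolvent (A : Matrix (Fin n) (Fin n) ℝ) (x : Fin n → ℝ)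
    (c : ℂ) (q : ℕ)
    (hq : (toComplexMatrix A - c • 1) ^ (q + 1) *ᵥ genEigenRep A x c = 0) :
    Tendsto (fun z : ℂ => (z - c) ^ (q + 1) • localResolvent A x z) (𝓝[≠] c)
      (𝓝 ((toComplexMatrix A - c • 1) ^ q *ᵥ genEigenRep A x c)) := by
  set w : ℂ → ℕ → Fin n → ℂ := fun μ i =>
    (toComplexMatrix A - μ • 1) ^ i *ᵥ genEigenRep A x μ with hw
  have hterm : ∀ μ ∈ (genEigenRep A x).support, ∀ i ∈ Finset.range n,
      Tendsto (fun z : ℂ => ((z - c) ^ (q + 1) * ((z - μ)⁻¹) ^ (i + 1)) • w μ i) (𝓝[≠] c)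
        (𝓝 (if μ = c then (if i = q then w c q else 0) else 0)) := by
    intro μ _ i _
    by_cases hμ : μ = c
    · subst hμ
      rcases tendsto_pow_mul_inv_pow μ q i with h | h
      · convert h.smul_const (w μ i) using 2
        by_cases hiq : i = q <;> simp [hiq]
      · have h0 : w μ i = 0 := pow_mulVec_eq_zero_of_le h hq
        simp [h0, h.ne']
    · have hcμ : c - μ ≠ 0 := sub_ne_zero.2 fun h => hμ h.symm
      have h : ContinuousAt (fun z : ℂ => ((z - c) ^ (q + 1) * ((z - μ)⁻¹) ^ (i + 1)) • w μ i)
          c := by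
        fun_prop (disch := assumption)
      have h' := h.tendsto.mono_left (nhdsWithin_le_nhds (s := {c}ᶜ))
      simpa [hμ] using h'
  have hsum := tendsto_finsetSum _ fun μ hμ => tendsto_finsetSum _ (hterm μ hμ)
  have hlim : ∑ μ ∈ (genEigenRep A x).support, ∑ i ∈ Finset.range n,
      (if μ = c then (if i = q then w c q else 0) else 0) = w c q := by
    have h0 : c ∉ (genEigenRep A x).support → w c q = 0 := fun h => by
      rw [hw]
      simp only [Finsupp.notMem_support_iff.1 h, Matrix.mulVec_zero]
    have h1 : n ≤ q → w c q = 0 := fun h =>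
      pow_mulVec_eq_zero_of_le h (pow_mulVec_genEigenRep A x c)
    have h2 : ∑ i ∈ Finset.range n, (if i = q then w c q else 0) = w c q := by
      rw [Finset.sum_ite_eq']
      split_ifs with h
      · rfl
      · exact (h1 (by simpa using h)).symm
    have h3 (μ : ℂ) : ∑ i ∈ Finset.range n,
        (if μ = c then (if i = q then w c q else 0) else 0) = if μ = c then w c q else 0 := by
      split_ifs
      · exact h2
      · simp
    simp only [h3]
    rw [Finset.sum_ite_eq']
    split_ifs with h
    · rfl
    · exact (h0 h).symm
  rw [hlim] at hsum
  refine hsum.congr fun z => ?_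
  rw [localResolvent, Finset.smul_sum]
  refine Finset.sum_congr rfl fun μ _ => ?_
  rw [Finset.smul_sum]
  exact Finset.sum_congr rfl fun i _ => (smul_smul _ _ _).symm

end Resolvent

/-! ### Comparison of spectral data along the cone order. -/

section Comparison

open Filter Topology

variable {n : ℕ} {K : PointedCone ℝ (Fin n → ℝ)} {A : Matrix (Fin n) (Fin n) ℝ}

theorem pow_mulVec_mem (hA : A ∈ conePreserving K) {x : Fin n → ℝ} (hx : x ∈ K) (k : ℕ) :
    A ^ k *ᵥ x ∈ K := by
  induction k with
  | zero => simpa using hx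
  | succ k ih =>
    rw [pow_succ', ← Matrix.mulVec_mulVec]
    exact hA _ ih

/-- Termwise comparison of Neumann series: `‖Aᵏx‖ ≤ f(Aᵏx) ≤ f(Aᵏu)`, because `A` preserves `K`. -/
theorem norm_localResolvent_le (hA : A ∈ conePreserving K) {f : StrongDual ℝ (Fin n → ℝ)}
    (hf : ∀ v ∈ K, ‖v‖ ≤ f v) {x u : Fin n → ℝ} (hx : x ∈ K) (hu : u - x ∈ K) {z : ℂ}
    (hzx : localSpectralRadius A x < ‖z‖) (hzu : localSpectralRadius A u < ‖z‖) :
    ‖localResolvent A x z‖ ≤ f (reVec n (localResolvent A u (‖z‖ : ℝ))) := by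
  refine (hasSum_localResolvent hzx).norm_le_of_bounded
    (hasSum_functional_localResolvent hzu f) fun k => ?_
  rw [norm_smul, norm_pow, norm_inv, norm_toComplexVec]
  refine mul_le_mul_of_nonneg_left ?_ (by positivity)
  have h1 := hf _ (pow_mulVec_mem hA hx k)
  have h2 := (norm_nonneg _).trans (hf _ (pow_mulVec_mem hA hu k))
  rw [Matrix.mulVec_sub, map_sub] at h2
  linarith

theorem tendsto_ofReal_mul_nhdsGT {σ : ℝ} {ω : ℂ} (hω : ω ≠ 0) :
    Tendsto (fun s : ℝ => (s : ℂ) * ω) (𝓝[>] σ) (𝓝[≠] (σ * ω)) := by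
  refine tendsto_nhdsWithin_iff.2 ⟨?_, ?_⟩
  · have h : Continuous fun s : ℝ => (s : ℂ) * ω := by fun_prop
    exact h.continuousAt.tendsto.mono_left nhdsWithin_le_nhds
  · filter_upwards [self_mem_nhdsWithin] with s hs
    rw [Set.mem_compl_singleton_iff, Ne, mul_left_inj' hω, Complex.ofReal_inj]
    exact (ne_of_gt hs)

theorem tendsto_functional_localResolvent (f : StrongDual ℝ (Fin n → ℝ)) {u : Fin n → ℝ} {σ : ℝ}
    {q : ℕ} (hq : (toComplexMatrix A - (σ : ℂ) • 1) ^ q *ᵥ genEigenRep A u σ = 0) :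
    Tendsto (fun s : ℝ => (s - σ) ^ (q + 1) * f (reVec n (localResolvent A u s))) (𝓝[>] σ)
      (𝓝 0) := by
  have h1 := (tendsto_sub_pow_smul_localResolvent A u σ q
    (pow_mulVec_eq_zero_of_le (Nat.le_succ q) hq)).comp
    (by simpa using tendsto_ofReal_mul_nhdsGT (σ := σ) one_ne_zero)
  rw [hq] at h1
  have h2 := ((f.comp (reVec n)).continuous.tendsto 0).comp h1
  rw [map_zero] at h2
  refine h2.congr fun s => ?_
  simp only [Function.comp]
  rw [← Complex.ofReal_sub, ← Complex.ofReal_pow, Complex.coe_smul, map_smul, smul_eq_mul,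
    ContinuousLinearMap.comp_apply]

/-- Comparison of spectral data: if `0 ≤ x ≤ u` in the cone order, then the components of `x` on
the circle of radius `σ` have order at most that of the component of `u` at `σ`. -/
theorem pow_mulVec_genEigenRep_eq_zero_of_le (hK : IsProperConeIn K) (hA : A ∈ conePreserving K)
    {x u : Fin n → ℝ} (hx : x ∈ K) (hu : u - x ∈ K) {σ : ℝ} (hσx : localSpectralRadius A x ≤ σ)
    (hσu : localSpectralRadius A u ≤ σ) {μ : ℂ} (hμ : ‖μ‖ = σ) {p : ℕ}
    (hp : (toComplexMatrix A - (σ : ℂ) • 1) ^ p *ᵥ genEigenRep A u σ = 0) :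
    (toComplexMatrix A - μ • 1) ^ p *ᵥ genEigenRep A x μ = 0 := by
  obtain ⟨f, hf⟩ := hK.exists_pos_functional
  -- The point `μ` will be approached radially along `sω` with `s ↓ σ`; for `μ = 0` any direction
  -- serves.
  obtain ⟨ω, hω, hμω⟩ : ∃ ω : ℂ, ‖ω‖ = 1 ∧ (σ : ℂ) * ω = μ := by
    by_cases h0 : μ = 0
    · subst h0
      exact ⟨1, norm_one, by simp [← hμ]⟩
    · have hσ : (σ : ℂ) ≠ 0 := by
        rw [← hμ]
        exact_mod_cast norm_ne_zero_iff.2 h0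
      refine ⟨μ / σ, ?_, mul_div_cancel₀ _ hσ⟩
      rw [norm_div, Complex.norm_real, ← hμ, norm_norm, div_self (norm_ne_zero_iff.2 h0)]
  have hω0 : ω ≠ 0 := norm_ne_zero_iff.1 (by rw [hω]; exact one_ne_zero)
  have hσ0 : 0 ≤ σ := hμ ▸ norm_nonneg μ
  rcases lt_or_ge n p with hnp | hnp
  · exact pow_mulVec_eq_zero_of_le hnp.le (pow_mulVec_genEigenRep A x μ)
  -- Lower the pole order of `x` at `μ` one unit at a time from `n` to `p`: the coefficient of order
  -- `q + 1` is bounded by a limit for `u` at `σ`, which is zero as long as `p ≤ q`.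
  refine Nat.decreasingInduction' (fun q _ hpq hq => ?_) hnp (pow_mulVec_genEigenRep A x μ)
  have h1 := (tendsto_sub_pow_smul_localResolvent A x μ q hq).comp
    (hμω ▸ tendsto_ofReal_mul_nhdsGT (σ := σ) hω0)
  have h2 := tendsto_functional_localResolvent f (pow_mulVec_eq_zero_of_le hpq hp)
  refine norm_le_zero_iff.1 (le_of_tendsto_of_tendsto h1.norm h2 ?_)
  filter_upwards [self_mem_nhdsWithin] with s hs
  have hs' : σ < s := hs
  have hz : ‖(s : ℂ) * ω‖ = s := by
    rw [norm_mul, hω, mul_one, Complex.norm_real, Real.norm_of_nonneg (hσ0.trans hs'.le)]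
  have h3 := norm_localResolvent_le hA hf hx hu (z := s * ω) (by rw [hz]; exact hσx.trans_lt hs')
    (by rw [hz]; exact hσu.trans_lt hs')
  rw [hz] at h3
  simp only [Function.comp]
  rw [← hμω, norm_smul, norm_pow, ← sub_mul, norm_mul, hω, mul_one, ← Complex.ofReal_sub,
    Complex.norm_real, Real.norm_of_nonneg (sub_nonneg.2 hs'.le)]
  exact mul_le_mul_of_nonneg_left h3 (pow_nonneg (sub_nonneg.2 hs'.le) _)

theorem localSpectralRadius_mono (hK : IsProperConeIn K) (hA : A ∈ conePreserving K)
    {x u : Fin n → ℝ} (hx : x ∈ K) (hu : u - x ∈ K) :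
    localSpectralRadius A x ≤ localSpectralRadius A u := by
  by_contra! hlt
  have hx0 : x ≠ 0 := by
    rintro rfl
    refine hlt.not_ge (localSpectralRadius_le (localSpectralRadius_nonneg A u) fun μ hμ => ?_)
    exact absurd (by rw [genEigenRep_eq_zero_iff.2 rfl, Finsupp.zero_apply]) hμ
  obtain ⟨μ, hμ, hnorm⟩ := exists_norm_eq_localSpectralRadius (A := A) hx0
  have hu0 : genEigenRep A u (localSpectralRadius A x : ℝ) = 0 := by
    by_contra h
    have := norm_le_localSpectralRadius h
    rw [Complex.norm_real, Real.norm_of_nonneg (localSpectralRadius_nonneg A x)] at this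
    exact hlt.not_ge this
  -- With `σ = ρ_x > ρ_u` the vector `u` has no component at `σ`, so order `0` transfers to `x`,
  -- against the choice of `μ`.
  have h := pow_mulVec_genEigenRep_eq_zero_of_le hK hA hx hu le_rfl hlt.le hnorm (p := 0)
    (by rw [hu0, Matrix.mulVec_zero])
  rw [pow_zero, Matrix.one_mulVec] at h
  exact hμ h

end Comparison

/-! ### Generated faces as sets of dominated vectors. -/

section Faces

variable {n : ℕ} {K : PointedCone ℝ (Fin n → ℝ)} {A : Matrix (Fin n) (Fin n) ℝ} {lam : ℝ}

/-- The vectors of `K` that are dominated by an element of the subcone `C`. -/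
def dominatedCone (K C : PointedCone ℝ (Fin n → ℝ)) : PointedCone ℝ (Fin n → ℝ) where
  carrier := {x | x ∈ K ∧ ∃ u ∈ C, u - x ∈ K}
  zero_mem' := ⟨K.zero_mem, 0, C.zero_mem, by simp⟩
  add_mem' := by
    rintro x y ⟨hx, u, hu, hux⟩ ⟨hy, v, hv, hvy⟩
    refine ⟨K.add_mem hx hy, u + v, C.add_mem hu hv, ?_⟩
    rw [add_sub_add_comm]
    exact K.add_mem hux hvy
  smul_mem' := by
    rintro c x ⟨hx, u, hu, hux⟩
    refine ⟨Submodule.smul_mem K c hx, c • u, Submodule.smul_mem C c hu, ?_⟩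
    rw [← smul_sub]
    exact Submodule.smul_mem K c hux

theorem dominatedCone_isFaceOf (K C : PointedCone ℝ (Fin n → ℝ)) :
    (dominatedCone K C).IsFaceOf K where
  le := fun _ hx => hx.1
  mem_of_smul_add_mem := by
    rintro x y a hx hy ha ⟨-, u, hu, hux⟩
    refine ⟨hx, a⁻¹ • u, C.smul_mem (inv_nonneg.2 ha.le) hu, ?_⟩
    have h := K.smul_mem (inv_nonneg.2 ha.le) (K.add_mem hux hy)
    rwa [show u - (a • x + y) + y = u - a • x by abel, smul_sub, smul_smul,
      inv_mul_cancel₀ ha.ne', one_smul] at h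

theorem mem_faceGen_iff {C : PointedCone ℝ (Fin n → ℝ)} (hC : C ≤ K) {x : Fin n → ℝ} :
    x ∈ faceGen K (C : Set (Fin n → ℝ)) ↔ x ∈ K ∧ ∃ u ∈ C, u - x ∈ K := by
  constructor
  · intro hx
    exact (Submodule.mem_sInf.1 hx) (dominatedCone K C) ⟨dominatedCone_isFaceOf K C,
      fun u hu => ⟨hC hu, u, hu, by simp⟩⟩
  · rintro ⟨hx, u, hu, hux⟩
    refine Submodule.mem_sInf.2 fun F hF => ?_
    refine hF.1.mem_of_add_mem_left hx hux ?_
    rw [add_sub_cancel]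
    exact hF.2 hu

/-- The set `N((λI - A)ⁿ) ∩ K` as a cone. -/
def genNullPointedCone (K : PointedCone ℝ (Fin n → ℝ)) (A : Matrix (Fin n) (Fin n) ℝ) (lam : ℝ) :
    PointedCone ℝ (Fin n → ℝ) :=
  K ⊓ PointedCone.ofSubmodule (LinearMap.ker (Matrix.mulVecLin ((A - lam • 1) ^ n)))

theorem mem_genNullPointedCone {x : Fin n → ℝ} :
    x ∈ genNullPointedCone K A lam ↔ x ∈ K ∧ (A - lam • 1) ^ n *ᵥ x = 0 := Iff.rfl

theorem coe_genNullPointedCone :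
    (genNullPointedCone K A lam : Set (Fin n → ℝ)) = genNullCone K A lam := by
  ext x
  have h : lam • (1 : Matrix (Fin n) (Fin n) ℝ) - A = -(A - lam • 1) := (neg_sub _ _).symm
  rw [SetLike.mem_coe, mem_genNullPointedCone, genNullCone, h, Set.mem_inter_iff, Set.mem_ofPred_eq,
    and_comm, SetLike.mem_coe]
  rcases Nat.even_or_odd n with he | ho
  · rw [he.neg_pow]
  · rw [ho.neg_pow, Matrix.neg_mulVec, neg_eq_zero]

theorem mem_faceGen_genNullCone_iff {x : Fin n → ℝ} :
    x ∈ faceGen K (genNullCone K A lam) ↔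
      x ∈ K ∧ ∃ u ∈ K, (A - lam • 1) ^ n *ᵥ u = 0 ∧ u - x ∈ K := by
  have h : genNullPointedCone K A lam ≤ K := inf_le_left
  rw [← coe_genNullPointedCone, mem_faceGen_iff h]
  simp only [mem_genNullPointedCone, and_assoc]

end Faces

/-! ### Separation from cones that need not be closed. -/

section Separation

variable {E : Type*} [NormedAddCommGroup E] [NormedSpace ℝ E] [FiniteDimensional ℝ E]

/-- In finite dimension a spanning convex cone has interior, so weak separation needs no closedness.
-/
theorem PointedCone.exists_functional_of_notMem {C : PointedCone ℝ E}
    (hC : Submodule.span ℝ (C : Set E) = ⊤) {v : E} (hv : v ∉ C) :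
    ∃ f : StrongDual ℝ E, f ≠ 0 ∧ (∀ c ∈ C, 0 ≤ f c) ∧ f v ≤ 0 := by
  have hint : (interior (C : Set E)).Nonempty := by
    rw [C.convex.interior_nonempty_iff_affineSpan_eq_top, ← SetLike.coe_set_eq,
      ← Set.insert_eq_of_mem (show (0 : E) ∈ (C : Set E) from C.zero_mem), affineSpan_insert_zero,
      hC]
    rfl
  obtain ⟨f, u, hf, hfC, hfv⟩ := geometric_hahn_banach_of_nonempty_interior C.convex
    (convex_singleton v) (Set.disjoint_singleton_right.2 fun h => hv (interior_subset h)) hint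
    (Set.singleton_nonempty v)
  have hfv' : u ≤ f v := hfv v rfl
  have hu : 0 ≤ u := by simpa using hfC 0 C.zero_mem
  refine ⟨-f, neg_ne_zero.2 hf, fun c hc => ?_, ?_⟩
  · rw [_root_.neg_apply, neg_nonneg]
    by_contra! hpos
    have h := hfC _ (C.smul_mem (r := (u + 1) / f c) (by positivity) hc)
    rw [map_smul, smul_eq_mul, div_mul_cancel₀ _ hpos.ne'] at h
    linarith
  · rw [_root_.neg_apply]
    linarith

/-- Otherwise a nonzero functional on the span weakly separates `w` from the hull; by hypothesis it
vanishes on all generators, hence on the span. -/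
theorem PointedCone.mem_hull_range_of_forall_functional {ι : Type*} {v : ι → E} {w : E}
    (hw : w ∈ Submodule.span ℝ (Set.range v))
    (h : ∀ f : StrongDual ℝ E, (∀ i, 0 ≤ f (v i)) → f w ≤ 0 → ∀ i, f (v i) = 0) :
    w ∈ PointedCone.hull ℝ (Set.range v) := by
  by_contra hnot
  set U := Submodule.span ℝ (Set.range v) with hU
  have hspan : Submodule.span ℝ
      (((PointedCone.hull ℝ (Set.range v)).comap U.subtype : PointedCone ℝ U) : Set U) = ⊤ := by
    rw [eq_top_iff, ← Submodule.span_span_coe_preimage (R := ℝ) (s := Set.range v)]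
    exact Submodule.span_mono fun x hx => PointedCone.subset_hull hx
  obtain ⟨f, hf, hfC, hfw⟩ := PointedCone.exists_functional_of_notMem hspan (v := ⟨w, hw⟩) hnot
  obtain ⟨g, hg⟩ := (f : U →ₗ[ℝ] ℝ).exists_extend
  have hgf (x : U) : g x = f x := LinearMap.congr_fun hg x
  have hvU (i : ι) : v i ∈ U := Submodule.subset_span ⟨i, rfl⟩
  have hgv := h g.toContinuousLinearMap (fun i => by
    have h1 := hfC ⟨v i, hvU i⟩ (PointedCone.subset_hull ⟨i, rfl⟩)
    rwa [← hgf] at h1) (by rw [← hgf] at hfw; exact hfw)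
  have hker : U ≤ LinearMap.ker g := by
    rw [hU, Submodule.span_le]
    rintro _ ⟨i, rfl⟩
    exact hgv i
  refine hf (ContinuousLinearMap.ext fun x => ?_)
  rw [← hgf, _root_.zero_apply]
  exact hker x.2

end Separation

/-! ### The main step: `x` lies in the face. -/

section ShiftedCone

open Filter Topology

variable {n : ℕ} {A : Matrix (Fin n) (Fin n) ℝ} {lam : ℝ}

theorem commute_sub_smul_one (A : Matrix (Fin n) (Fin n) ℝ) (r : ℝ) : Commute A (A - r • 1) :=
  (Commute.refl A).sub_right ((Commute.one_right A).smul_right r)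

theorem functional_pow_mulVec_nonpos {y : Fin n → ℝ} (hy : localSpectralRadius A y ≤ lam)
    (hy0 : genEigenRep A y lam = 0) (g : StrongDual ℝ (Fin n → ℝ)) (hgy : 0 ≤ g y)
    (hg : ∀ k : ℕ, 0 ≤ g (A ^ k *ᵥ (A - lam • 1) *ᵥ y)) (j : ℕ) :
    g (A ^ j *ᵥ (A - lam • 1) *ᵥ y) ≤ 0 := by
  have hlam : 0 ≤ lam := (localSpectralRadius_nonneg A y).trans hy
  have hd (k : ℕ) : g (A ^ k *ᵥ (A - lam • 1) *ᵥ y) =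
      g (A ^ (k + 1) *ᵥ y) - lam * g (A ^ k *ᵥ y) := by
    rw [Matrix.mulVec_mulVec, mul_sub, ← pow_succ, mul_smul_comm, mul_one, Matrix.sub_mulVec,
      Matrix.smul_mulVec, map_sub, map_smul, smul_eq_mul]
  have h1 := tendsto_functional_localResolvent (A := A) (u := y) (σ := lam) (q := 0) g (by
    rw [hy0, Matrix.mulVec_zero])
  -- The factor `s ^ (j + 1)` clears the weight of the `j`-th term before the limit, which also
  -- covers `lam = 0`.
  have hcont : Continuous fun s : ℝ => s ^ (j + 1) := by fun_prop
  have h2 := (hcont.continuousAt (x := lam)).tendsto.mono_left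
    (nhdsWithin_le_nhds (s := Set.Ioi lam))
  have h3 := h2.mul h1
  rw [mul_zero] at h3
  refine ge_of_tendsto h3 ?_
  filter_upwards [self_mem_nhdsWithin] with s hs
  have hs' : lam < s := hs
  have hs0 : 0 < s := hlam.trans_lt hs'
  set F := g (reVec n (localResolvent A y s))
  have hF : HasSum (fun k : ℕ => (s⁻¹) ^ (k + 1) * g (A ^ k *ᵥ y)) F :=
    hasSum_functional_localResolvent (hy.trans_lt hs') g
  have hF1 := ((hasSum_nat_add_iff' 1).2 hF).mul_left s |>.sub (hF.mul_left lam)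
  have hval : s * (F - ∑ i ∈ Finset.range 1, (s⁻¹) ^ (i + 1) * g (A ^ i *ᵥ y)) - lam * F =
      (s - lam) * F - g y := by
    simp only [Finset.sum_range_one, zero_add, pow_one, pow_zero, Matrix.one_mulVec]
    field_simp
    ring
  rw [hval] at hF1
  have hF2 : HasSum (fun k : ℕ => (s⁻¹) ^ (k + 1) * g (A ^ k *ᵥ (A - lam • 1) *ᵥ y))
      ((s - lam) * F - g y) := by
    refine hF1.congr_fun fun k => ?_
    rw [hd, pow_succ (s⁻¹) (k + 1)]
    field_simp
  have h4 := le_hasSum hF2 j fun k _ => mul_nonneg (by positivity) (hg k)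
  rw [zero_add, pow_one]
  calc g (A ^ j *ᵥ (A - lam • 1) *ᵥ y)
      = s ^ (j + 1) * ((s⁻¹) ^ (j + 1) * g (A ^ j *ᵥ (A - lam • 1) *ᵥ y)) := by
        rw [← mul_assoc, ← mul_pow, mul_inv_cancel₀ hs0.ne', one_pow, one_mul]
    _ ≤ s ^ (j + 1) * ((s - lam) * F) :=
        mul_le_mul_of_nonneg_left (by linarith) (by positivity)

/-- By Fitting, `B = A - lam • 1` is injective on the range of `Bⁿ`. The span is a `B`-invariant
subspace of that range, so `B` is bijective on it; as it contains `B(Bⁿx)`, it contains `Bⁿx`. -/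
theorem pow_sub_mulVec_mem_span (A : Matrix (Fin n) (Fin n) ℝ) (lam : ℝ) (x : Fin n → ℝ) :
    (A - lam • 1) ^ n *ᵥ x ∈ Submodule.span ℝ (Set.range fun k : ℕ =>
      A ^ k *ᵥ (A - lam • 1) *ᵥ (A - lam • 1) ^ n *ᵥ x) := by
  set B := A - lam • (1 : Matrix (Fin n) (Fin n) ℝ) with hB
  set U := Submodule.span ℝ (Set.range fun k : ℕ => A ^ k *ᵥ B *ᵥ B ^ n *ᵥ x) with hU
  have hAB : Commute A B := commute_sub_smul_one A lam
  have hinj {v : Fin n → ℝ} (h : B *ᵥ B ^ n *ᵥ v = 0) : B ^ n *ᵥ v = 0 := by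
    rw [Matrix.mulVec_mulVec, ← pow_succ'] at h
    exact pow_mulVec_eq_zero_of_exists ⟨n + 1, h⟩
  have hrange {v : Fin n → ℝ} (hv : v ∈ U) : ∃ w, B ^ n *ᵥ w = v := by
    have hle : U ≤ LinearMap.range (Matrix.mulVecLin (B ^ n)) := by
      rw [hU, Submodule.span_le]
      rintro _ ⟨k, rfl⟩
      refine ⟨A ^ k *ᵥ B *ᵥ x, ?_⟩
      simp only [Matrix.mulVecLin_apply, Matrix.mulVec_mulVec]
      rw [← mul_assoc, ← mul_assoc, (hAB.pow_pow k n).symm.eq, mul_assoc, ← pow_succ,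
        mul_assoc, ← pow_succ']
    exact hle hv
  have hmap : ∀ v ∈ U, Matrix.mulVecLin B v ∈ U := by
    intro v hv
    refine (Submodule.span_le.2 ?_ : U ≤ U.comap (Matrix.mulVecLin B)) hv
    rintro _ ⟨k, rfl⟩
    rw [SetLike.mem_coe, Submodule.mem_comap, Matrix.mulVecLin_apply]
    nth_rewrite 1 [hB]
    rw [Matrix.sub_mulVec, Matrix.smul_mulVec, Matrix.one_mulVec]
    refine U.sub_mem (Submodule.subset_span ⟨k + 1, ?_⟩)
      (U.smul_mem _ (Submodule.subset_span ⟨k, rfl⟩))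
    simp only [pow_succ', Matrix.mulVec_mulVec, mul_assoc]
  have hinjU : Function.Injective ((Matrix.mulVecLin B).restrict hmap) := by
    rw [injective_iff_map_eq_zero]
    rintro ⟨v, hv⟩ h
    obtain ⟨w, rfl⟩ := hrange hv
    exact Subtype.ext (hinj (congrArg Subtype.val h))
  obtain ⟨⟨v, hv⟩, h⟩ := LinearMap.injective_iff_surjective.1 hinjU
    ⟨B *ᵥ B ^ n *ᵥ x, Submodule.subset_span ⟨0, by simp⟩⟩
  have h' : B *ᵥ v = B *ᵥ B ^ n *ᵥ x := congrArg Subtype.val h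
  obtain ⟨w, rfl⟩ := hrange hv
  have h0 := hinj (v := x - w) (by rw [Matrix.mulVec_sub, Matrix.mulVec_sub, h', sub_self])
  rw [Matrix.mulVec_sub, sub_eq_zero] at h0
  rwa [h0]

theorem neg_pow_sub_mulVec_mem_hull {x : Fin n → ℝ} (hx : localSpectralRadius A x ≤ lam) :
    -((A - lam • 1) ^ n *ᵥ x) ∈ PointedCone.hull ℝ (Set.range fun k : ℕ =>
      A ^ k *ᵥ (A - lam • 1) *ᵥ (A - lam • 1) ^ n *ᵥ x) := by
  refine PointedCone.mem_hull_range_of_forall_functional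
    (Submodule.neg_mem _ (pow_sub_mulVec_mem_span A lam x)) fun g hg hgy j => ?_
  refine le_antisymm (functional_pow_mulVec_nonpos ?_ ?_ g ?_ hg j) (hg j)
  · exact (localSpectralRadius_mulVec_le ((commute_sub_smul_one A lam).pow_right n) x).trans hx
  · rw [genEigenRep_sub_smul_pow_mulVec, pow_mulVec_genEigenRep]
  · rwa [map_neg, neg_nonpos] at hgy

variable {K : PointedCone ℝ (Fin n → ℝ)}

theorem mem_faceGen_of_sub_smul_mulVec_mem (hA : A ∈ conePreserving K) {x : Fin n → ℝ}
    (hx : x ∈ K) (hb : (A - lam • 1) *ᵥ x ∈ K)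
    (hρ : localSpectralRadius A ((A - lam • 1) *ᵥ x) ≤ lam) :
    x ∈ faceGen K (genNullCone K A lam) := by
  have hlam : 0 ≤ lam := (localSpectralRadius_nonneg _ _).trans hρ
  have hρx : localSpectralRadius A x ≤ lam := by
    refine localSpectralRadius_le hlam fun μ hμ => ?_
    by_cases hμl : μ = lam
    · rw [hμl, Complex.norm_real, Real.norm_of_nonneg hlam]
    -- Away from `lam` the shift is injective on generalized eigenvectors, so `x` has no component
    -- at `μ` that its image lacks.
    · refine (norm_le_localSpectralRadius fun h0 => hμ ?_).trans hρ
      have h1 := genEigenRep_sub_smul_pow_mulVec A lam 1 x μ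
      rw [pow_one, h0] at h1
      exact eq_zero_of_sub_smul_mulVec_eq_zero hμl (pow_mulVec_genEigenRep A x μ) h1.symm
  have hle : PointedCone.hull ℝ (Set.range fun k : ℕ =>
      A ^ k *ᵥ (A - lam • 1) *ᵥ (A - lam • 1) ^ n *ᵥ x) ≤
        K.map (Matrix.mulVecLin ((A - lam • 1) ^ n)) := by
    refine Submodule.span_le.2 ?_
    rintro _ ⟨k, rfl⟩
    refine PointedCone.mem_map.2 ⟨A ^ k *ᵥ (A - lam • 1) *ᵥ x, pow_mulVec_mem hA hb k, ?_⟩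
    simp only [Matrix.mulVecLin_apply, Matrix.mulVec_mulVec]
    rw [← mul_assoc, ((commute_sub_smul_one A lam).pow_pow k n).symm.eq, mul_assoc, ← pow_succ,
      ← pow_succ']
  obtain ⟨v, hv, hvx⟩ := PointedCone.mem_map.1 (hle (neg_pow_sub_mulVec_mem_hull hρx))
  refine mem_faceGen_genNullCone_iff.2 ⟨hx, x + v, K.add_mem hx hv, ?_, by simpa using hv⟩
  rw [Matrix.mulVec_add, ← Matrix.mulVecLin_apply _ v, hvx, add_neg_cancel]

end ShiftedCone

/-! ### Spectral bounds on the face and on its image. -/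

section DistinguishedEigenvalue

variable {n : ℕ} {K : PointedCone ℝ (Fin n → ℝ)} {A : Matrix (Fin n) (Fin n) ℝ} {lam : ℝ}

theorem IsDistinguishedEigenvalue.nonneg (hK : IsProperConeIn K) (hA : A ∈ conePreserving K)
    (h : IsDistinguishedEigenvalue K A lam) : 0 ≤ lam := by
  obtain ⟨x, hx, hx0, hAx⟩ := h
  by_contra! hneg
  refine hx0 (hK.eq_zero_of_neg_mem hx ?_)
  have h1 := K.smul_mem (inv_nonneg.2 (neg_nonneg.2 hneg.le)) (hA x hx)
  rwa [hAx, smul_smul, ← div_eq_inv_mul, div_neg, div_self hneg.ne, neg_one_smul] at h1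

theorem genOrder_spec {R : Type*} [CommRing R] {B : Matrix (Fin n) (Fin n) R} {μ : R}
    {v : Fin n → R} (h : ∃ p : ℕ, ((B - μ • 1) ^ p) *ᵥ v = 0) :
    0 < genOrder B μ v ∧ ((B - μ • 1) ^ genOrder B μ v) *ᵥ v = 0 := by
  obtain ⟨p, hp⟩ := h
  exact Nat.sInf_mem (s := {p : ℕ | 0 < p ∧ ((B - μ • 1) ^ p) *ᵥ v = 0})
    ⟨p + 1, p.succ_pos, pow_mulVec_eq_zero_of_le p.le_succ hp⟩

theorem IsDistinguishedEigenvalue.maxDistOrder_pos (h : IsDistinguishedEigenvalue K A lam) :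
    0 < maxDistOrder K A lam := by
  obtain ⟨x, hx, hxm⟩ := (maxDistOrder_isGreatest h).1
  exact hxm ▸ (genOrder_spec hx.2.2).1

theorem IsDistinguishedEigenvalue.pow_maxDistOrder_mulVec
    (h : IsDistinguishedEigenvalue K A lam) {u : Fin n → ℝ} (hu : u ∈ K) {p : ℕ}
    (hp : (A - lam • 1) ^ p *ᵥ u = 0) : (A - lam • 1) ^ maxDistOrder K A lam *ᵥ u = 0 := by
  rcases eq_or_ne u 0 with rfl | hu0
  · rw [Matrix.mulVec_zero]
  · exact pow_mulVec_eq_zero_of_le ((maxDistOrder_isGreatest h).2 ⟨u, ⟨hu, hu0, p, hp⟩, rfl⟩)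
      (genOrder_spec ⟨p, hp⟩).2

theorem localSpectralRadius_le_of_pow_mulVec_eq_zero (hlam : 0 ≤ lam) {u : Fin n → ℝ} {p : ℕ}
    (hp : (A - lam • 1) ^ p *ᵥ u = 0) : localSpectralRadius A u ≤ lam := by
  refine localSpectralRadius_le hlam fun μ hμ => ?_
  rw [genEigenRep_of_pow_mulVec_eq_zero hp] at hμ
  have hμl : (lam : ℂ) = μ := by
    by_contra hne
    exact hμ (Finsupp.single_eq_of_ne' hne)
  rw [← hμl, Complex.norm_real, Real.norm_of_nonneg hlam]

theorem localSpectralRadius_le_of_mem_faceGen (hK : IsProperConeIn K) (hA : A ∈ conePreserving K)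
    (hlam : 0 ≤ lam) {x : Fin n → ℝ} (hx : x ∈ faceGen K (genNullCone K A lam)) :
    localSpectralRadius A x ≤ lam := by
  obtain ⟨hxK, u, -, hu0, hux⟩ := mem_faceGen_genNullCone_iff.1 hx
  exact (localSpectralRadius_mono hK hA hxK hux).trans
    (localSpectralRadius_le_of_pow_mulVec_eq_zero hlam hu0)

theorem sub_smul_mulVec_mem_faceGen (hA : A ∈ conePreserving K) (hlam : 0 ≤ lam)
    {x : Fin n → ℝ} (hx : x ∈ faceGen K (genNullCone K A lam)) (hb : (A - lam • 1) *ᵥ x ∈ K) :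
    (A - lam • 1) *ᵥ x ∈ faceGen K (genNullCone K A lam) := by
  obtain ⟨hxK, u, hu, hu0, hux⟩ := mem_faceGen_genNullCone_iff.1 hx
  refine mem_faceGen_genNullCone_iff.2 ⟨hb, A *ᵥ u, hA u hu, ?_, ?_⟩
  · rw [Matrix.mulVec_mulVec, ← ((commute_sub_smul_one A lam).pow_right n).eq,
      ← Matrix.mulVec_mulVec, hu0, Matrix.mulVec_zero]
  -- `Au - (A - λI)x = A(u - x) + λx`.
  · have h := K.add_mem (hA _ hux) (K.smul_mem hlam hxK)
    convert h using 1
    rw [Matrix.sub_mulVec, Matrix.smul_mulVec, Matrix.one_mulVec, Matrix.mulVec_sub]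
    abel

theorem vecOrder_sub_smul_mulVec_le (hK : IsProperConeIn K) (hA : A ∈ conePreserving K)
    (h : IsDistinguishedEigenvalue K A lam) {x : Fin n → ℝ}
    (hx : x ∈ faceGen K (genNullCone K A lam)) (hb : (A - lam • 1) *ᵥ x ∈ K)
    (hρ : localSpectralRadius A ((A - lam • 1) *ᵥ x) = lam) :
    vecOrder A ((A - lam • 1) *ᵥ x) ≤ maxDistOrder K A lam - 1 := by
  have hlam := h.nonneg hK hA
  have hnorm : ‖(lam : ℂ)‖ = lam := by rw [Complex.norm_real, Real.norm_of_nonneg hlam]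
  have hm := h.maxDistOrder_pos
  obtain ⟨hxK, u, hu, hu0, hux⟩ := mem_faceGen_genNullCone_iff.1 hx
  have hum := h.pow_maxDistOrder_mulVec hu hu0
  have hxm : (toComplexMatrix A - (lam : ℂ) • 1) ^ maxDistOrder K A lam *ᵥ
      genEigenRep A x lam = 0 := by
    refine pow_mulVec_genEigenRep_eq_zero_of_le hK hA hxK hux
      (localSpectralRadius_le_of_mem_faceGen hK hA hlam hx)
      (localSpectralRadius_le_of_pow_mulVec_eq_zero hlam hu0) hnorm ?_
    rw [← genEigenRep_sub_smul_pow_mulVec, hum, genEigenRep_eq_zero_iff.2 rfl, Finsupp.zero_apply]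
  have hbm : (toComplexMatrix A - (lam : ℂ) • 1) ^ (maxDistOrder K A lam - 1) *ᵥ
      genEigenRep A ((A - lam • 1) *ᵥ x) lam = 0 := by
    have h1 := genEigenRep_sub_smul_pow_mulVec A lam 1 x lam
    rw [pow_one, pow_one] at h1
    rw [h1, Matrix.mulVec_mulVec, ← pow_succ, Nat.sub_add_cancel hm, hxm]
  refine Finset.sup_le fun μ hμ => ?_
  rw [Finset.mem_filter, Finsupp.mem_support_iff, hρ] at hμ
  -- Comparing the vector with itself passes the order bound from `lam` to every eigenvalue of the
  -- same modulus.
  have hμm := pow_mulVec_genEigenRep_eq_zero_of_le hK hA hb (by simp) hρ.le hρ.le hμ.2 hbm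
  -- Orders are positive, so `m_λ - 1 = 0` must be excluded: it would make the component at `μ`
  -- vanish.
  refine Nat.sInf_le ⟨Nat.pos_of_ne_zero fun h0 => hμ.1 ?_, hμm⟩
  rwa [h0, pow_zero, Matrix.one_mulVec] at hμm

end DistinguishedEigenvalue

/-! ### Assembly of the theorem. -/

theorem theorem4p6 {n : ℕ} (K : PointedCone ℝ (Fin n → ℝ)) (hK : IsProperConeIn K)
    (A : Matrix (Fin n) (Fin n) ℝ) (hA : A ∈ conePreserving K) :
    (∀ lam : ℝ, IsDistinguishedEigenvalue K A lam →
      (fun x => (A - lam • (1 : Matrix (Fin n) (Fin n) ℝ)) *ᵥ x) '' (K : Set (Fin n → ℝ)) ∩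
          {b | b ∈ K ∧ localSpectralRadius A b ≤ lam} =
        (K : Set (Fin n → ℝ)) ∩
          (fun x => (A - lam • (1 : Matrix (Fin n) (Fin n) ℝ)) *ᵥ x) ''
            (faceGen K (genNullCone K A lam) : Set (Fin n → ℝ)) ∧
      (K : Set (Fin n → ℝ)) ∩
          (fun x => (A - lam • (1 : Matrix (Fin n) (Fin n) ℝ)) *ᵥ x) ''
            (faceGen K (genNullCone K A lam) : Set (Fin n → ℝ)) ⊆
        (faceGen K (genNullCone K A lam) : Set (Fin n → ℝ)) ∩
          {y | y ∈ K ∧ PairLE (spectralPair A y) (lam, (maxDistOrder K A lam : ℝ) - 1)}) ∧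
    (∀ b ∈ K,
      (∃ x ∈ K, (A - localSpectralRadius A b • (1 : Matrix (Fin n) (Fin n) ℝ)) *ᵥ x = b) →
      b ∈ (fun x => (A - localSpectralRadius A b • (1 : Matrix (Fin n) (Fin n) ℝ)) *ᵥ x) ''
        (faceGen K (genNullCone K A (localSpectralRadius A b)) : Set (Fin n → ℝ))) := by
  refine ⟨fun lam h => ?_, ?_⟩
  · have hlam := h.nonneg hK hA
    refine ⟨Set.Subset.antisymm ?_ ?_, ?_⟩
    · rintro _ ⟨⟨x, hx, rfl⟩, hb, hρ⟩
      exact ⟨hb, x, mem_faceGen_of_sub_smul_mulVec_mem hA hx hb hρ, rfl⟩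
    · rintro _ ⟨hb, x, hx, rfl⟩
      exact ⟨⟨x, (mem_faceGen_genNullCone_iff.1 hx).1, rfl⟩, hb,
        (localSpectralRadius_mulVec_le (commute_sub_smul_one A lam) x).trans
          (localSpectralRadius_le_of_mem_faceGen hK hA hlam hx)⟩
    · rintro _ ⟨hb, x, hx, rfl⟩
      refine ⟨sub_smul_mulVec_mem_faceGen hA hlam hx hb, hb, ?_⟩
      have hρ : localSpectralRadius A ((A - lam • 1) *ᵥ x) ≤ lam :=
        (localSpectralRadius_mulVec_le (commute_sub_smul_one A lam) x).trans
          (localSpectralRadius_le_of_mem_faceGen hK hA hlam hx)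
      rcases hρ.lt_or_eq with hlt | heq
      · exact Or.inl hlt
      · refine Or.inr ⟨heq, ?_⟩
        have hord := vecOrder_sub_smul_mulVec_le hK hA h hx hb heq
        have hm := h.maxDistOrder_pos
        have hord' : vecOrder A ((A - lam • 1) *ᵥ x) + 1 ≤ maxDistOrder K A lam := by omega
        have hcast : (vecOrder A ((A - lam • 1) *ᵥ x) : ℝ) + 1 ≤ maxDistOrder K A lam := by
          exact_mod_cast hord'
        exact le_sub_iff_add_le.2 hcast
  · rintro b hb ⟨x, hx, hxb⟩
    refine ⟨x, mem_faceGen_of_sub_smul_mulVec_mem hA hx ?_ ?_, hxb⟩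
    · rwa [hxb]
    · rw [hxb]
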